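/- Let $p>2$, $q\ge 0$, $m\ge 0$ be integers, and let $\mathbf X=(\mathbf X_I,\mathbf X_J)$ be a random vector in $\mathbb R^{p}\times\mathbb R^{q}$ with law $\mathbb P$, where $\mathbf X_I=(X_1,\dots,X_p)$. Let $\mathbf X_1,\mathbf X_2,\dots$ be i.i.d. copies of $\mathbf X$. Let $A_1,\dots,A_m\subset\mathbb R^{q}$ be Borel sets (not necessarily disjoint) with $p_k:=\mathbb P(\mathbf X_J\in A_k)>0$, and put $p_{k,l}:=\mathbb P(\mathbf X_J\in A_k\cap A_l)$ and $\mathbb P_k:=\mathbb P(\,\cdot\mid \mathbf X_J\in A_k)$. For $1\le a<b\le p$ and $1\le k\le m$ set $$\hat D_{a,b,k}:=\frac1{n(n-1)}\sum_{i=1}^n\sum_{j\ne i}\mathbf 1\{X_{i,a}<X_{j,a},\,X_{i,b}<X_{j,b},\,\mathbf X_{i,J}\in A_k,\,\mathbf X_{j,J}\in A_k\},\qquad \hat p_k:=\frac1n\sum_{i=1}^n\mathbf 1\{\mathbf X_{i,J}\in A_k\},$$ $$D_{a,b,k}:=\mathbb P\big(X_{1,a}<X_{2,a},\,X_{1,b}<X_{2,b},\,\mathbf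 X_{1,J}\in A_k,\,\mathbf X_{2,J}\in A_k\big),$$ $$\pi_{a,b}(\mathbf x,\mathbf y):=\tfrac12\big(\mathbf 1\{x_a<y_a,\,x_b<y_b\}+\mathbf 1\{y_a<x_a,\,y_b<x_b\}\big),$$ and, for $1\le a<b\le p$, $1\le a'<b'\le p$ and $1\le k,l\le m$, $$I_{a,b,a',b',k,l}:=\int \mathbf 1\{\mathbf x_{3,J}\in A_k\cap A_l\}\,\pi_{a,b}(\mathbf x_1,\mathbf x_3)\,\pi_{a',b'}(\mathbf x_2,\mathbf x_3)\,\mathbb P_k(d\mathbf x_1)\,\mathbb P_l(d\mathbf x_2)\,\mathbb P(d\mathbf x_3),$$ $$J_{a,b,k,l}:=\int \mathbf 1\{\mathbf x_{2,J}\in A_k\cap A_l\}\,\pi_{a,b}(\mathbf x_1,\mathbf x_2)\,\mathbb P_k(d\mathbf x_1)\,\mathbb P(d\mathbf x_2).$$ Let $\hat{\mathbf V}$ be the vector of dimension $m\,p(p-1)/2+m$ that stacks all $\hat D_{a,b,k}-D_{a,b,k}$ ($a<b$, $1\le k\le m$) and all $\hat p_k-p_k$ ($1\le k\le m$). Then,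 as $n\to\infty$, $\sqrt n\,\hat{\mathbf V}$ converges in law to the centered Gaussian vector $\mathcal N(0,\Sigma_e)$, where the (symmetric positive semidefinite) block matrix $\Sigma_e$ has, for all pairs $a<b$ and $a'<b'$, the $m\times m$ blocks $$\Sigma_{(a,b),(a',b')}=\big[4p_kp_l\,I_{a,b,a',b',k,l}-4D_{a,b,k}D_{a',b',l}\big]_{1\le k,l\le m},$$ $$\Sigma_{(a,b),0}=\Sigma_{0,(a,b)}'=\big[2p_k\,J_{a,b,k,l}-2D_{a,b,k}\,p_l\big]_{1\le k,l\le m},\qquad \Sigma_{0,0}=\big[p_{k,l}-p_kp_l\big]_{1\le k,l\le m},$$ the index $0$ referring to the coordinates $\hat p_k-p_k$. -/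

import Mathlib

open MeasureTheory ProbabilityTheory Filter

noncomputable section

namespace CondKendall

/-- The space `ℝ^d`, `d = p + q`, of the values `x = (x_I, x_J)`: the `p` conditioned coordinates
`x_I = x.1` and the `q` conditioning coordinates `x_J = x.2`. -/
abbrev Obs (p q : ℕ) : Type := (Fin p → ℝ) × (Fin q → ℝ)

/-- The pairs of indices `(a, b)` with `a < b`. -/
abbrev Pairs (p : ℕ) : Type := {ab : Fin p × Fin p // ab.1 < ab.2}

/-- The coordinates of the stacked vector: first the triples `(a, b, k)` with `a < b`, then the
indices `k` of the conditioning sets. -/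
abbrev Idx (p m : ℕ) : Type := (Pairs p × Fin m) ⊕ Fin m

/-- The event `{x_J ∈ A}`. -/
def condEvent (p : ℕ) {q : ℕ} (A : Set (Fin q → ℝ)) : Set (Obs p q) := {x | x.2 ∈ A}

/-- The set of `(x, y)` with `x_a < y_a`, `x_b < y_b`. -/
def ltEvent {p : ℕ} (q : ℕ) (a b : Fin p) : Set (Obs p q × Obs p q) :=
  {z | z.1.1 a < z.2.1 a ∧ z.1.1 b < z.2.1 b}

/-- The set of `(x, y)` with `x_a < y_a`, `x_b < y_b`, `x_J ∈ A`, `y_J ∈ A`. -/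
def pairEvent {p q : ℕ} (a b : Fin p) (A : Set (Fin q → ℝ)) : Set (Obs p q × Obs p q) :=
  {z | z.1.1 a < z.2.1 a ∧ z.1.1 b < z.2.1 b ∧ z.1.2 ∈ A ∧ z.2.2 ∈ A}

/-- The indicator function of a set, with real values. -/
def ind {α : Type*} (s : Set α) : α → ℝ := s.indicator (fun _ => 1)

section Statistics

variable {p q : ℕ}

/-- `D̂_{a,b,k}` for `A = A_k`, computed on the first `n` points of the sample `x`. -/
def DHat (A : Set (Fin q → ℝ)) (n : ℕ) (a b : Fin p) (x : ℕ → Obs p q) : ℝ :=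
  1 / ((n : ℝ) * ((n : ℝ) - 1)) *
    ∑ i ∈ Finset.range n, ∑ j ∈ (Finset.range n).erase i, ind (pairEvent a b A) (x i, x j)

/-- `p̂_k` for `A = A_k`, computed on the first `n` points of the sample `x`. -/
def pHat (A : Set (Fin q → ℝ)) (n : ℕ) (x : ℕ → Obs p q) : ℝ :=
  1 / (n : ℝ) * ∑ i ∈ Finset.range n, ind (condEvent p A) (x i)

end Statistics

section Population

variable {p q m : ℕ} (μ : Measure (Obs p q)) (A : Fin m → Set (Fin q → ℝ))

/-- `p_k = P(X_J ∈ A_k)`, where `μ` is the law of `X`. -/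
def prob (k : Fin m) : ℝ := μ.real (condEvent p (A k))

/-- `p_{k,l} = P(X_J ∈ A_k ∩ A_l)`. -/
def prob₂ (k l : Fin m) : ℝ := μ.real (condEvent p (A k ∩ A l))

/-- `P_k`, the law of `X` given `X_J ∈ A_k`. -/
def condLaw (k : Fin m) : Measure (Obs p q) := ProbabilityTheory.cond μ (condEvent p (A k))

/-- `D_{a,b,k} = P(X_{1,a} < X_{2,a}, X_{1,b} < X_{2,b}, X_{1,J} ∈ A_k, X_{2,J} ∈ A_k)` for
independent `X_1`, `X_2` of law `μ`. -/
def D (a b : Fin p) (k : Fin m) : ℝ := (μ.prod μ).real (pairEvent a b (A k))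

/-- `π_{a,b}(x, y) = (1{x_a < y_a, x_b < y_b} + 1{y_a < x_a, y_b < x_b}) / 2`. -/
def conc (a b : Fin p) (x y : Obs p q) : ℝ :=
  (ind (ltEvent q a b) (x, y) + ind (ltEvent q a b) (y, x)) / 2

/-- `I_{a,b,a',b',k,l}`. -/
def I (a b a' b' : Fin p) (k l : Fin m) : ℝ :=
  ∫ x₃, ∫ x₂, ∫ x₁, ind (condEvent p (A k ∩ A l)) x₃ * conc a b x₁ x₃ * conc a' b' x₂ x₃
    ∂(condLaw μ A k) ∂(condLaw μ A l) ∂μ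

/-- `J_{a,b,k,l}`. -/
def J (a b : Fin p) (k l : Fin m) : ℝ :=
  ∫ x₂, ∫ x₁, ind (condEvent p (A k ∩ A l)) x₂ * conc a b x₁ x₂ ∂(condLaw μ A k) ∂μ

/-- The part of `Σ_e` made of the blocks `Σ_{(a,b),(a',b')}`. -/
def sigmaDD : Matrix (Pairs p × Fin m) (Pairs p × Fin m) ℝ :=
  Matrix.of fun r s =>
    4 * prob μ A r.2 * prob μ A s.2 * I μ A r.1.1.1 r.1.1.2 s.1.1.1 s.1.1.2 r.2 s.2
      - 4 * D μ A r.1.1.1 r.1.1.2 r.2 * D μ A s.1.1.1 s.1.1.2 s.2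

/-- The part of `Σ_e` made of the blocks `Σ_{(a,b),0}`. -/
def sigmaDp : Matrix (Pairs p × Fin m) (Fin m) ℝ :=
  Matrix.of fun r l =>
    2 * prob μ A r.2 * J μ A r.1.1.1 r.1.1.2 r.2 l
      - 2 * D μ A r.1.1.1 r.1.1.2 r.2 * prob μ A l

/-- The block `Σ_{0,0}`. -/
def sigmapp : Matrix (Fin m) (Fin m) ℝ :=
  Matrix.of fun k l => prob₂ μ A k l - prob μ A k * prob μ A l

/-- The block matrix `Σ_e`. -/
def sigmaE : Matrix (Idx p m) (Idx p m) ℝ :=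
  Matrix.fromBlocks (sigmaDD μ A) (sigmaDp μ A) (sigmaDp μ A).transpose (sigmapp μ A)

/-- The stacked vector `V̂` of the `D̂_{a,b,k} - D_{a,b,k}` and the `p̂_k - p_k`, computed on the
first `n` points of the sample `x`. -/
def VHat (n : ℕ) (x : ℕ → Obs p q) : EuclideanSpace ℝ (Idx p m) :=
  WithLp.toLp 2 (Sum.elim
    (fun r => DHat (A r.2) n r.1.1.1 r.1.1.2 x - D μ A r.1.1.1 r.1.1.2 r.2)
    (fun k => pHat (A k) n x - prob μ A k))

end Population

end CondKendall

end

/-! Each `DHat` is a U-statistic of order two with a bounded kernel, and each `pHat` is an empirical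
mean. Subtracting from the kernel its two conditional expectations leaves a completely degenerate
kernel. The values of that kernel at distinct unordered pairs are orthogonal, so its normalized sum,
multiplied by `√n`, has second moment O(1/n) (`integral_sq_remainder_le`). Hence `√n • VHat` differs
by a term vanishing in probability from a normalized centred sum of the i.i.d. vectors `influence`,
and Slutsky's lemma reduces the claim to the multivariate central limit theorem.

The limiting covariance is that of `influence`. Conditioning on `X_J ∈ A_k` turns the projection of
the kernel into `2 p_k 1{x_J ∈ A_k} ∫ π(y, x) P_k(dy)` (`influence_inl_apply`), and the integrals of
products of such functions are the quantities `I` and `J`; this is `sigmaE_eq_covMatrix`, which also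
gives positive semidefiniteness. -/

/-! ### Hájek projection of U-statistics of order two with bounded kernel. -/

namespace UStatistic

variable {E F Ω : Type*} [MeasurableSpace E] [MeasurableSpace F] [MeasurableSpace Ω]

/-- The sum of the two conditional expectations of a kernel `h` given one of its arguments; for
symmetric `h` this is twice the first Hoeffding projection. -/
noncomputable def hoeffdingProj (μ : Measure E) (h : E × E → ℝ) (x : E) : ℝ :=
  (∫ y, h (x, y) ∂μ) + ∫ y, h (y, x) ∂μ

/-- The completely degenerate part of a kernel in its Hoeffding decomposition. -/
noncomputable def degenerateKernel (μ : Measure E) (h : E × E → ℝ) (z : E × E) : ℝ :=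
  h z - (∫ y, h (z.1, y) ∂μ) - (∫ x, h (x, z.2) ∂μ) + ∫ w, h w ∂(μ.prod μ)

theorem abs_integral_le_of_bound {μ : Measure E} [IsProbabilityMeasure μ] {f : E → ℝ} {C : ℝ}
    (hf : ∀ x, |f x| ≤ C) : |∫ x, f x ∂μ| ≤ C := by
  simpa using norm_integral_le_of_norm_le_const (μ := μ) (f := f) (ae_of_all _ hf)

theorem integrable_of_abs_le {μ : Measure E} [IsFiniteMeasure μ] {f : E → ℝ} {C : ℝ}
    (hm : AEMeasurable f μ) (hf : ∀ x, |f x| ≤ C) : Integrable f μ :=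
  Integrable.of_bound hm.aestronglyMeasurable C (ae_of_all _ hf)

section Kernel

variable {μ : Measure E} [IsProbabilityMeasure μ] {h : E × E → ℝ} {C : ℝ}

theorem measurable_integral_left (hm : Measurable h) : Measurable fun x => ∫ y, h (x, y) ∂μ :=
  hm.stronglyMeasurable.integral_prod_right'.measurable

theorem measurable_integral_right (hm : Measurable h) : Measurable fun y => ∫ x, h (x, y) ∂μ :=
  hm.stronglyMeasurable.integral_prod_left'.measurable

theorem measurable_hoeffdingProj (hm : Measurable h) : Measurable (hoeffdingProj μ h) :=
  (measurable_integral_left hm).add (measurable_integral_right hm)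

theorem abs_hoeffdingProj_le (hC : ∀ z, |h z| ≤ C) (x : E) : |hoeffdingProj μ h x| ≤ 2 * C := by
  have h1 := abs_integral_le_of_bound (μ := μ) fun y => hC (x, y)
  have h2 := abs_integral_le_of_bound (μ := μ) fun y => hC (y, x)
  have := abs_add_le (∫ y, h (x, y) ∂μ) (∫ y, h (y, x) ∂μ)
  unfold hoeffdingProj
  linarith

theorem integral_hoeffdingProj (hm : Measurable h) (hC : ∀ z, |h z| ≤ C) :
    ∫ x, hoeffdingProj μ h x ∂μ = 2 * ∫ z, h z ∂(μ.prod μ) := by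
  have hi : Integrable h (μ.prod μ) := integrable_of_abs_le hm.aemeasurable hC
  unfold hoeffdingProj
  rw [integral_add hi.integral_prod_left hi.integral_prod_right, ← integral_prod _ hi,
    ← integral_prod_symm _ hi, two_mul]

theorem measurable_degenerateKernel (hm : Measurable h) : Measurable (degenerateKernel μ h) :=
  ((hm.sub ((measurable_integral_left hm).comp measurable_fst)).sub
    ((measurable_integral_right hm).comp measurable_snd)).add_const _

theorem abs_degenerateKernel_le (hC : ∀ z, |h z| ≤ C) (z : E × E) :
    |degenerateKernel μ h z| ≤ 4 * C := by
  have h0 := abs_le.1 (hC z)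
  have h1 := abs_le.1 (abs_integral_le_of_bound (μ := μ) fun y => hC (z.1, y))
  have h2 := abs_le.1 (abs_integral_le_of_bound (μ := μ) fun y => hC (y, z.2))
  have h3 := abs_le.1 (abs_integral_le_of_bound (μ := μ.prod μ) hC)
  unfold degenerateKernel
  rw [abs_le]
  constructor <;> linarith

theorem integral_degenerateKernel_fst (hm : Measurable h) (hC : ∀ z, |h z| ≤ C) (y : E) :
    ∫ x, degenerateKernel μ h (x, y) ∂μ = 0 := by
  have hi : Integrable h (μ.prod μ) := integrable_of_abs_le hm.aemeasurable hC
  have h1 : Integrable (fun x => h (x, y)) μ :=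
    integrable_of_abs_le (hm.comp (by fun_prop)).aemeasurable fun x => hC (x, y)
  have h2 := hi.integral_prod_left
  simp only [degenerateKernel]
  rw [integral_add (by exact (h1.sub h2).sub (integrable_const _)) (integrable_const _),
    integral_sub (by exact h1.sub h2) (integrable_const _), integral_sub h1 h2, integral_prod _ hi]
  simp

theorem integral_degenerateKernel_snd (hm : Measurable h) (hC : ∀ z, |h z| ≤ C) (x : E) :
    ∫ y, degenerateKernel μ h (x, y) ∂μ = 0 := by
  have hi : Integrable h (μ.prod μ) := integrable_of_abs_le hm.aemeasurable hC
  have h1 : Integrable (fun y => h (x, y)) μ :=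
    integrable_of_abs_le (hm.comp (by fun_prop)).aemeasurable fun y => hC (x, y)
  have h2 := hi.integral_prod_right
  simp only [degenerateKernel]
  rw [integral_add (by exact (h1.sub (integrable_const _)).sub h2) (integrable_const _),
    integral_sub (by exact h1.sub (integrable_const _)) h2, integral_sub h1 (by fun_prop),
    integral_prod_symm _ hi]
  simp

end Kernel

/-- By independence the joint law is a product, so Fubini allows `Y` to be integrated out first; the
law of `Z` plays no role. -/
theorem integral_comp_prodMk_eq_zero {μ : Measure E} [IsProbabilityMeasure μ]
    {P : Measure Ω} [IsProbabilityMeasure P] {Y : Ω → E} {Z : Ω → F}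
    (hY : HasLaw Y μ P) (hZ : AEMeasurable Z P) (hYZ : IndepFun Y Z P)
    {f : E × F → ℝ} {C : ℝ} (hm : Measurable f) (hC : ∀ z, |f z| ≤ C)
    (h0 : ∀ z, ∫ y, f (y, z) ∂μ = 0) :
    ∫ ω, f (Y ω, Z ω) ∂P = 0 := by
  have : IsProbabilityMeasure (P.map Z) := Measure.isProbabilityMeasure_map hZ
  rw [← integral_map (φ := fun ω => (Y ω, Z ω)) (hY.aemeasurable.prodMk hZ)
    hm.aestronglyMeasurable, hYZ.map_prod_eq_prod_map_map hY.aemeasurable hZ, hY.map_eq,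
    integral_prod_symm _ (integrable_of_abs_le hm.aemeasurable hC)]
  simp [h0]

theorem sum_offDiag {s : Finset ℕ} (f : ℕ → ℕ → ℝ) :
    ∑ z ∈ s.offDiag, f z.1 z.2 = ∑ i ∈ s, ∑ j ∈ s.erase i, f i j := by
  have : s.offDiag = (s ×ˢ s).filter fun z => z.1 ≠ z.2 := by
    ext z
    simp [and_assoc]
  rw [this, Finset.sum_filter, Finset.sum_product]
  refine Finset.sum_congr rfl fun i _ => ?_
  rw [← Finset.sum_filter]
  refine Finset.sum_congr ?_ fun _ _ => rfl
  ext j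
  simp [and_comm, eq_comm]

/-- Hoeffding decomposition of a sum over ordered pairs. -/
theorem sum_offDiag_degenerateKernel (μ : Measure E) (h : E × E → ℝ) (n : ℕ) (x : ℕ → E) :
    ∑ z ∈ (Finset.range n).offDiag, degenerateKernel μ h (x z.1, x z.2)
      = (∑ i ∈ Finset.range n, ∑ j ∈ (Finset.range n).erase i, h (x i, x j))
        - ((n : ℝ) - 1) * ∑ i ∈ Finset.range n, hoeffdingProj μ h (x i)
        + (n : ℝ) * ((n : ℝ) - 1) * ∫ w, h w ∂(μ.prod μ) := by
  have e1 : ∀ f : ℕ → ℝ, ∑ z ∈ (Finset.range n).offDiag, f z.1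
      = ((n : ℝ) - 1) * ∑ i ∈ Finset.range n, f i := fun f => by
    rw [sum_offDiag (fun i _ => f i), Finset.mul_sum]
    refine Finset.sum_congr rfl fun i hi => ?_
    rw [Finset.sum_const, Finset.card_erase_of_mem hi, Finset.card_range, nsmul_eq_mul,
      Nat.cast_pred (Nat.pos_of_ne_zero (by rintro rfl; simp at hi))]
  have e2 : ∀ f : ℕ → ℝ, ∑ z ∈ (Finset.range n).offDiag, f z.2
      = ((n : ℝ) - 1) * ∑ i ∈ Finset.range n, f i := fun f => by
    rw [← e1]
    exact Finset.sum_nbij' Prod.swap Prod.swap (by simp +contextual [eq_comm])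
      (by simp +contextual [eq_comm]) (by simp) (by simp) (by simp)
  simp only [degenerateKernel, hoeffdingProj, Finset.sum_add_distrib, Finset.sum_sub_distrib]
  rw [sum_offDiag (fun i j => h (x i, x j)), e1 fun i => ∫ y, h (x i, y) ∂μ,
    e2 fun j => ∫ y, h (y, x j) ∂μ, e1 fun _ => ∫ w, h w ∂(μ.prod μ)]
  simp
  ring

section Sample

variable {μ : Measure E} [IsProbabilityMeasure μ] {P : Measure Ω} [IsProbabilityMeasure P]
  {X : ℕ → Ω → E}

omit [IsProbabilityMeasure P] in
theorem indepFun_of_notMem (hindep : iIndepFun X P) (hX : ∀ i, AEMeasurable (X i) P)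
    {u : ℕ} {s : Finset ℕ} (hu : u ∉ s) :
    IndepFun (X u) (fun ω (i : s) => X i ω) P := by
  have h := hindep.indepFun_finset₀ {u} s (by simpa using hu) hX
  exact h.comp (measurable_pi_apply (⟨u, by simp⟩ : ({u} : Finset ℕ))) measurable_id

/-- The index `u` occurs only once, so `X u` can be integrated out with the other variables frozen.
The indices `v`, `w`, `t` may coincide, which is why the others are gathered in a family indexed by
a finset. -/
theorem integral_mul_eq_zero (hindep : iIndepFun X P) (hlaw : ∀ i, HasLaw (X i) μ P)
    {f g : E × E → ℝ} {K : ℝ} (hf : Measurable f) (hg : Measurable g)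
    (hfK : ∀ z, |f z| ≤ K) (hgK : ∀ z, |g z| ≤ K) (h0 : ∀ y, ∫ x, f (x, y) ∂μ = 0)
    {u v w t : ℕ} (hv : u ≠ v) (hw : u ≠ w) (ht : u ≠ t) :
    ∫ ω, f (X u ω, X v ω) * g (X w ω, X t ω) ∂P = 0 := by
  have hX : ∀ i, AEMeasurable (X i) P := fun i => (hlaw i).aemeasurable
  let s : Finset ℕ := {v, w, t}
  have hus : u ∉ s := by simp [s, hv, hw, ht]
  let F : E × (s → E) → ℝ := fun z =>
    f (z.1, z.2 ⟨v, by simp [s]⟩) * g (z.2 ⟨w, by simp [s]⟩, z.2 ⟨t, by simp [s]⟩)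
  refine integral_comp_prodMk_eq_zero (hlaw u)
    (aemeasurable_pi_lambda (fun ω (i : s) => X i ω) fun i => hX i)
    (indepFun_of_notMem hindep hX hus) (f := F) (C := K * K) ?_ ?_ ?_
  · exact (hf.comp (by fun_prop)).mul (hg.comp (by fun_prop))
  · intro z
    rw [abs_mul]
    exact mul_le_mul (hfK _) (hgK _) (abs_nonneg _) ((abs_nonneg _).trans (hfK (z.1, z.1)))
  · intro z
    simp only [F]
    rw [integral_mul_const, h0, zero_mul]

/-- Distinct unordered pairs give orthogonal values of a completely degenerate kernel. -/
theorem integral_mul_eq_zero_of_ne (hindep : iIndepFun X P) (hlaw : ∀ i, HasLaw (X i) μ P)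
    {k : E × E → ℝ} {K : ℝ} (hk : Measurable k) (hK : ∀ z, |k z| ≤ K)
    (h1 : ∀ y, ∫ x, k (x, y) ∂μ = 0) (h2 : ∀ x, ∫ y, k (x, y) ∂μ = 0)
    {z w : ℕ × ℕ} (hz : z.1 ≠ z.2) (hzw : z ≠ w) (hzw' : z ≠ w.swap) :
    ∫ ω, k (X z.1 ω, X z.2 ω) * k (X w.1 ω, X w.2 ω) ∂P = 0 := by
  obtain ⟨i, j⟩ := z
  obtain ⟨i', j'⟩ := w
  simp only [ne_eq, Prod.swap_prod_mk, Prod.mk.injEq, not_and] at *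
  -- Since `z` is neither `w` nor its swap, one of its two indices does not occur in `w`; that one
  -- is integrated out.
  by_cases hi : i ≠ i' ∧ i ≠ j'
  · exact integral_mul_eq_zero hindep hlaw hk hk hK hK h1 hz hi.1 hi.2
  · exact integral_mul_eq_zero hindep hlaw (f := fun z => k z.swap) (hk.comp measurable_swap) hk
      (fun z => hK _) hK h2 (Ne.symm hz) (by grind) (by grind)

/-- When the square is expanded, each ordered pair `z` has a nonzero product at most with `z` and
`z.swap`, whence the factor 2. -/
theorem integral_sq_sum_offDiag_le (hindep : iIndepFun X P) (hlaw : ∀ i, HasLaw (X i) μ P)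
    {k : E × E → ℝ} {K : ℝ} (hk : Measurable k) (hK : ∀ z, |k z| ≤ K)
    (h1 : ∀ y, ∫ x, k (x, y) ∂μ = 0) (h2 : ∀ x, ∫ y, k (x, y) ∂μ = 0) (n : ℕ) :
    ∫ ω, (∑ z ∈ (Finset.range n).offDiag, k (X z.1 ω, X z.2 ω)) ^ 2 ∂P
      ≤ ((n : ℝ) * ((n : ℝ) - 1)) * (2 * K ^ 2) := by
  have hX : ∀ i, AEMeasurable (X i) P := fun i => (hlaw i).aemeasurable
  have hkX : ∀ i j, AEMeasurable (fun ω => k (X i ω, X j ω)) P := fun i j =>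
    hk.comp_aemeasurable ((hX i).prodMk (hX j))
  have hb : ∀ z w, |k z * k w| ≤ K ^ 2 := fun z w => by
    rw [abs_mul, sq]
    exact mul_le_mul (hK _) (hK _) (abs_nonneg _) ((abs_nonneg _).trans (hK z))
  have hint : ∀ z w : ℕ × ℕ,
      Integrable (fun ω => k (X z.1 ω, X z.2 ω) * k (X w.1 ω, X w.2 ω)) P := fun z w =>
    integrable_of_abs_le ((hkX _ _).mul (hkX _ _)) fun ω => hb _ _
  simp_rw [sq (∑ z ∈ _, _), Finset.sum_mul_sum]
  rw [integral_finsetSum _ fun z _ => integrable_finsetSum _ fun w _ => hint z w]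
  have key : ∀ z ∈ (Finset.range n).offDiag,
      ∫ ω, ∑ w ∈ (Finset.range n).offDiag, k (X z.1 ω, X z.2 ω) * k (X w.1 ω, X w.2 ω) ∂P
        ≤ 2 * K ^ 2 := by
    intro z hz
    rw [integral_finsetSum _ fun w _ => hint z w]
    calc ∑ w ∈ (Finset.range n).offDiag, ∫ ω, k (X z.1 ω, X z.2 ω) * k (X w.1 ω, X w.2 ω) ∂P
        ≤ ∑ w ∈ (Finset.range n).offDiag, if w ∈ ({z, z.swap} : Finset (ℕ × ℕ))
            then K ^ 2 else 0 := by
          refine Finset.sum_le_sum fun w _ => ?_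
          split_ifs with h
          · exact (le_abs_self _).trans (abs_integral_le_of_bound fun ω => hb _ _)
          · simp only [Finset.mem_insert, Finset.mem_singleton, not_or] at h
            refine (integral_mul_eq_zero_of_ne hindep hlaw hk hK h1 h2
              (Finset.mem_offDiag.1 hz).2.2 (Ne.symm h.1) fun h' => h.2 ?_).le
            rw [h', Prod.swap_swap]
      _ ≤ 2 * K ^ 2 := by
          rw [← Finset.sum_filter, Finset.sum_const, nsmul_eq_mul]
          have hc : ((Finset.range n).offDiag.filter
              (· ∈ ({z, z.swap} : Finset (ℕ × ℕ)))).card ≤ 2 :=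
            (Finset.card_le_card fun w hw => (Finset.mem_filter.1 hw).2).trans
              Finset.card_le_two
          have : (((Finset.range n).offDiag.filter
              (· ∈ ({z, z.swap} : Finset (ℕ × ℕ)))).card : ℝ) ≤ 2 := by exact_mod_cast hc
          gcongr
  refine (Finset.sum_le_sum key).trans_eq ?_
  rw [Finset.sum_const, nsmul_eq_mul, Finset.offDiag_card, Finset.card_range,
    Nat.cast_sub (Nat.le_mul_self n)]
  push_cast
  ring

/-- The remainder in the Hájek projection of the U-statistic of order two with kernel `h`. -/
noncomputable def remainder (μ : Measure E) (h : E × E → ℝ) (n : ℕ) (x : ℕ → E) : ℝ :=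
  Real.sqrt n * (1 / ((n : ℝ) * ((n : ℝ) - 1)) *
      (∑ i ∈ Finset.range n, ∑ j ∈ (Finset.range n).erase i, h (x i, x j)) - ∫ z, h z ∂(μ.prod μ))
    - (Real.sqrt n)⁻¹ * (∑ i ∈ Finset.range n, hoeffdingProj μ h (x i)
      - n * ∫ x, hoeffdingProj μ h x ∂μ)

theorem memLp_remainder (hX : ∀ i, AEMeasurable (X i) P) {h : E × E → ℝ} {C : ℝ}
    (hm : Measurable h) (hC : ∀ z, |h z| ≤ C) (n : ℕ) :
    MemLp (fun ω => remainder μ h n fun i => X i ω) 2 P := by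
  have h1 : ∀ i j, MemLp (fun ω => h (X i ω, X j ω)) 2 P := fun i j =>
    MemLp.of_bound (hm.comp_aemeasurable ((hX i).prodMk (hX j))).aestronglyMeasurable C
      (ae_of_all _ fun ω => hC _)
  have h2 : ∀ i, MemLp (fun ω => hoeffdingProj μ h (X i ω)) 2 P := fun i =>
    MemLp.of_bound ((measurable_hoeffdingProj hm).comp_aemeasurable (hX i)).aestronglyMeasurable
      (2 * C) (ae_of_all _ fun ω => abs_hoeffdingProj_le hC _)
  exact ((((memLp_finsetSum _ fun i _ => memLp_finsetSum _ fun j _ => h1 i j).const_mul _).sub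
    (memLp_const _)).const_mul _).sub
    (((memLp_finsetSum _ fun i _ => h2 i).sub (memLp_const _)).const_mul _)

/-- The degenerate kernel is bounded by `4 * C`, so `32 * C ^ 2 = 2 * (4 * C) ^ 2`; the scaling
contributes `n / (n (n - 1))²` against `n (n - 1)` pairs. -/
theorem integral_sq_remainder_le (hindep : iIndepFun X P) (hlaw : ∀ i, HasLaw (X i) μ P)
    {h : E × E → ℝ} {C : ℝ} (hm : Measurable h) (hC : ∀ z, |h z| ≤ C) {n : ℕ} (hn : 2 ≤ n) :
    ∫ ω, (remainder μ h n fun i => X i ω) ^ 2 ∂P ≤ 32 * C ^ 2 * (1 / ((n : ℝ) - 1)) := by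
  have hn' : (2 : ℝ) ≤ n := by exact_mod_cast hn
  have hs : Real.sqrt n ≠ 0 := by positivity
  have hs2 : Real.sqrt n ^ 2 = n := Real.sq_sqrt (by positivity)
  have h1 : (n : ℝ) - 1 ≠ 0 := by linarith
  have e : ∀ ω, (remainder μ h n fun i => X i ω)
      = Real.sqrt n / ((n : ℝ) * ((n : ℝ) - 1)) *
        ∑ z ∈ (Finset.range n).offDiag, degenerateKernel μ h (X z.1 ω, X z.2 ω) := by
    intro ω
    rw [remainder, sum_offDiag_degenerateKernel μ h n fun i => X i ω,
      integral_hoeffdingProj hm hC]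
    field_simp
    rw [hs2]
    ring
  simp_rw [e, mul_pow]
  rw [integral_const_mul]
  have hle := integral_sq_sum_offDiag_le hindep hlaw (measurable_degenerateKernel (μ := μ) hm)
    (abs_degenerateKernel_le hC) (integral_degenerateKernel_fst hm hC)
    (integral_degenerateKernel_snd hm hC) n
  refine (mul_le_mul_of_nonneg_left hle (sq_nonneg _)).trans_eq ?_
  rw [div_pow, hs2]
  field_simp
  ring

theorem tendsto_integral_sq_remainder (hindep : iIndepFun X P) (hlaw : ∀ i, HasLaw (X i) μ P)
    {h : E × E → ℝ} {C : ℝ} (hm : Measurable h) (hC : ∀ z, |h z| ≤ C) :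
    Tendsto (fun n : ℕ => ∫ ω, (remainder μ h n fun i => X i ω) ^ 2 ∂P) atTop (nhds 0) := by
  have hlim : Tendsto (fun n : ℕ => 32 * C ^ 2 * (1 / ((n : ℝ) - 1))) atTop (nhds 0) := by
    have : Tendsto (fun n : ℕ => (n : ℝ) - 1) atTop atTop :=
      tendsto_atTop_add_const_right _ (-1) tendsto_natCast_atTop_atTop
    simpa using this.inv_tendsto_atTop.const_mul (32 * C ^ 2)
  refine tendsto_of_tendsto_of_tendsto_of_le_of_le' tendsto_const_nhds hlim
    (Eventually.of_forall fun n => integral_nonneg fun ω => sq_nonneg _) ?_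
  filter_upwards [eventually_ge_atTop 2] with n hn
  exact integral_sq_remainder_le hindep hlaw hm hC hn

end Sample

/-- Markov's inequality for `‖W n‖ ^ 2` at level `ε ^ 2`, the squared norm being the sum of the
squared coordinates. -/
theorem tendstoInMeasure_of_tendsto_integral_sq {ι : Type*} [Fintype ι] {P : Measure Ω}
    [IsProbabilityMeasure P] {W : ℕ → Ω → EuclideanSpace ℝ ι}
    (hW : ∀ n i, MemLp (fun ω => W n ω i) 2 P)
    (h : ∀ i, Tendsto (fun n => ∫ ω, (W n ω i) ^ 2 ∂P) atTop (nhds 0)) :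
    TendstoInMeasure P W atTop 0 := by
  rw [tendstoInMeasure_iff_measureReal_norm]
  intro ε hε
  have hsum : Tendsto (fun n => (∑ i, ∫ ω, (W n ω i) ^ 2 ∂P) / ε ^ 2) atTop (nhds 0) := by
    simpa using (tendsto_finsetSum Finset.univ fun i _ => h i).div_const (ε ^ 2)
  refine squeeze_zero (fun n => measureReal_nonneg) (fun n => ?_) hsum
  have hmarkov := mul_meas_ge_le_integral_of_nonneg (μ := P) (f := fun ω => ‖W n ω‖ ^ 2)
    (ae_of_all _ fun ω => sq_nonneg _)
    (by simpa only [EuclideanSpace.real_norm_sq_eq] using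
      integrable_finsetSum _ fun i _ => (hW n i).integrable_sq) (ε ^ 2)
  simp only [EuclideanSpace.real_norm_sq_eq] at hmarkov
  rw [integral_finsetSum _ fun i _ => (hW n i).integrable_sq] at hmarkov
  rw [le_div_iff₀ (by positivity), mul_comm]
  refine le_trans (le_of_eq ?_) hmarkov
  congr 2
  ext ω
  simp only [Set.mem_ofPred_eq, Pi.zero_apply, sub_zero, ← EuclideanSpace.real_norm_sq_eq]
  exact (pow_le_pow_iff_left₀ hε.le (norm_nonneg _) two_ne_zero).symm

end UStatistic

/-! ### Multivariate central limit theorem by the Cramér–Wold device. -/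

namespace MultivariateCLT

open scoped Topology Matrix RealInnerProductSpace

variable {ι E Ω : Type*} [Fintype ι] [MeasurableSpace E] [MeasurableSpace Ω]

/-- The covariance matrix of a finite family of real random variables. -/
noncomputable def covMatrix (μ : Measure E) (f : ι → E → ℝ) : Matrix ι ι ℝ :=
  Matrix.of fun i j => cov[f i, f j; μ]

variable {μ : Measure E} [IsProbabilityMeasure μ] {f : ι → E → ℝ}

/-- Used twice: for positive semidefiniteness, and to match the Gaussian characteristic function
with the one-dimensional limit. -/
theorem dotProduct_covMatrix_mulVec (hf : ∀ i, MemLp (f i) 2 μ) (t : ι → ℝ) :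
    t ⬝ᵥ covMatrix μ f *ᵥ t = Var[fun x => ∑ i, t i * f i x; μ] := by
  rw [variance_fun_sum fun i => (hf i).const_mul (t i)]
  simp only [covariance_const_mul_left, covariance_const_mul_right, dotProduct, Matrix.mulVec,
    covMatrix, Matrix.of_apply, Finset.mul_sum]
  refine Finset.sum_congr rfl fun i _ => Finset.sum_congr rfl fun j _ => by ring

theorem posSemidef_covMatrix (hf : ∀ i, MemLp (f i) 2 μ) : (covMatrix μ f).PosSemidef := by
  refine Matrix.PosSemidef.of_dotProduct_mulVec_nonneg ?_ fun t => ?_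
  · ext i j
    simp [covMatrix, covariance_comm]
  · rw [star_trivial, dotProduct_covMatrix_mulVec hf]
    exact variance_nonneg _ _

/-- The multivariate central limit theorem for i.i.d. observations. -/
theorem tendstoInDistribution_inv_sqrt_smul_sum_sub [DecidableEq ι]
    {P : Measure Ω} [IsProbabilityMeasure P] {X : ℕ → Ω → E}
    (hindep : iIndepFun X P) (hlaw : ∀ i, HasLaw (X i) μ P)
    (hm : ∀ i, Measurable (f i)) (hf : ∀ i, MemLp (f i) 2 μ) :
    TendstoInDistribution
      (fun (n : ℕ) ω => (WithLp.toLp 2 fun i =>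
        (Real.sqrt n)⁻¹ * (∑ k ∈ Finset.range n, f i (X k ω) - n * ∫ x, f i x ∂μ) :
        EuclideanSpace ℝ ι))
      atTop (fun v : EuclideanSpace ℝ ι => v) (fun _ => P)
      (multivariateGaussian 0 (covMatrix μ f)) := by
  have hX : ∀ i, AEMeasurable (X i) P := fun i => (hlaw i).aemeasurable
  have hXm : ∀ n : ℕ, AEMeasurable (fun ω => (WithLp.toLp 2 fun i =>
      (Real.sqrt n)⁻¹ * (∑ k ∈ Finset.range n, f i (X k ω) - n * ∫ x, f i x ∂μ) :
      EuclideanSpace ℝ ι)) P := fun n =>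
    (WithLp.measurable_toLp 2 (ι → ℝ)).comp_aemeasurable (aemeasurable_pi_lambda _ fun i =>
      ((Finset.aemeasurable_fun_sum _ fun k _ =>
        (hm i).comp_aemeasurable (hX k)).sub_const _).const_mul _)
  refine ⟨hXm, aemeasurable_id, ?_⟩
  refine ProbabilityMeasure.tendsto_iff_tendsto_charFun.2 fun t => ?_
  -- The characteristic function of the vector at `t` is that of the normalized sum of the scalars
  -- `g (X k)` at 1, so the one-dimensional theorem applies.
  let g : E → ℝ := fun x => ∑ i, t i * f i x
  have hgm : Measurable g := Finset.measurable_fun_sum _ fun i _ => (hm i).const_mul _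
  have hg : MemLp g 2 μ := memLp_finsetSum _ fun i _ => (hf i).const_mul _
  have hgi : ∫ x, g x ∂μ = ∑ i, t i * ∫ x, f i x ∂μ := by
    simp only [g]
    rw [integral_finsetSum _ fun i _ => ((hf i).integrable one_le_two).const_mul _]
    simp [integral_const_mul]
  have hgX : ∀ i, HasLaw (fun ω => g (X i ω)) (μ.map g) P := fun i =>
    ⟨hgm.comp_aemeasurable (hX i), by
      rw [← (hlaw i).map_eq, AEMeasurable.map_map_of_aemeasurable hgm.aemeasurable (hX i)]
      rfl⟩
  have hvar : Var[fun ω => g (X 0 ω); P] = Var[g; μ] := by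
    rw [← (hlaw 0).map_eq, variance_map hgm.aemeasurable (hX 0)]
    rfl
  have hint : ∫ ω, g (X 0 ω) ∂P = ∫ x, g x ∂μ := by
    rw [← (hlaw 0).map_eq, integral_map (hX 0) hgm.aestronglyMeasurable]
  have hL : MemLp (fun ω => g (X 0 ω)) 2 P := by
    rw [← (hlaw 0).map_eq] at hg
    exact (memLp_map_measure_iff hgm.aestronglyMeasurable (hX 0)).1 hg
  have hclt := ProbabilityTheory.tendstoInDistribution_inv_sqrt_mul_sum_sub
    (P := P) (X := fun i ω => g (X i ω)) (Y := fun y : ℝ => y)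
    (P' := gaussianReal 0 Var[fun ω => g (X 0 ω); P].toNNReal)
    ⟨aemeasurable_id, Measure.map_id⟩ hL (hindep.comp (fun _ => g) fun _ => hgm)
    fun i => ⟨(hgX i).aemeasurable, (hgX 0).aemeasurable,
      (hgX i).map_eq.trans (hgX 0).map_eq.symm⟩
  have hc := ProbabilityMeasure.tendsto_iff_tendsto_charFun.1 hclt.tendsto 1
  simp only [ProbabilityMeasure.coe_mk] at hc ⊢
  have hlim : charFun (Measure.map (fun v : EuclideanSpace ℝ ι => v)
      (multivariateGaussian 0 (covMatrix μ f))) t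
      = charFun (Measure.map (fun y : ℝ => y)
        (gaussianReal 0 Var[fun ω => g (X 0 ω); P].toNNReal)) 1 := by
    rw [Measure.map_id', Measure.map_id',
      charFun_multivariateGaussian (posSemidef_covMatrix hf), charFun_gaussianReal, hvar]
    have := dotProduct_covMatrix_mulVec hf t.ofLp
    rw [Real.coe_toNNReal _ (variance_nonneg _ _), this]
    simp [g]
  rw [hlim]
  refine hc.congr fun n => ?_
  rw [charFun_apply, charFun_apply, integral_map, integral_map]
  · refine integral_congr_ae (ae_of_all _ fun ω => ?_)
    have e : inner ℝ ((Real.sqrt n)⁻¹ * (∑ k ∈ Finset.range n, g (X k ω)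
          - n * ∫ ω, g (X 0 ω) ∂P)) 1
        = inner ℝ (WithLp.toLp 2 fun i => (Real.sqrt n)⁻¹ *
          (∑ k ∈ Finset.range n, f i (X k ω) - n * ∫ x, f i x ∂μ)) t := by
      rw [hint, hgi, PiLp.inner_apply]
      simp only [g, RCLike.inner_apply, conj_trivial, one_mul]
      rw [Finset.sum_comm, Finset.mul_sum, ← Finset.sum_sub_distrib, Finset.mul_sum]
      refine Finset.sum_congr rfl fun i _ => ?_
      rw [← Finset.mul_sum]
      ring
    simp only [e]
  · exact hXm n
  · fun_prop
  · exact hclt.forall_aemeasurable n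
  · fun_prop

end MultivariateCLT

/-! ### Linearization of the stacked vector and computation of its covariance. -/

namespace CondKendall

open UStatistic MultivariateCLT

variable {p q m : ℕ}

theorem card_pairs (p : ℕ) : Fintype.card (Pairs p) = p * (p - 1) / 2 := by
  -- Pairs are fibred over the larger index `b`, whose fibre has `b` elements.
  let e : Pairs p ≃ Σ b : Fin p, {a : Fin p // a < b} :=
    { toFun := fun r => ⟨r.1.2, r.1.1, r.2⟩
      invFun := fun s => ⟨(s.2.1, s.1), s.2.2⟩
      left_inv := fun _ => rfl
      right_inv := fun _ => rfl }
  rw [Fintype.card_congr e, Fintype.card_sigma, ← Finset.sum_range_id,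
    ← Fin.sum_univ_eq_sum_range (fun i => i)]
  refine Finset.sum_congr rfl fun b _ => ?_
  rw [Fintype.card_subtype, ← Fin.card_Iio b]
  congr 1
  ext a
  simp

theorem card_idx (p m : ℕ) : Fintype.card (Idx p m) = m * (p * (p - 1) / 2) + m := by
  rw [Fintype.card_sum, Fintype.card_prod, card_pairs, Fintype.card_fin, mul_comm]

section Indicators

variable {α : Type*}

theorem ind_apply (s : Set α) [DecidablePred (· ∈ s)] (x : α) :
    ind s x = if x ∈ s then 1 else 0 := by
  simp [ind, Set.indicator_apply]

theorem abs_ind_le (s : Set α) (x : α) : |ind s x| ≤ 1 := by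
  classical
  rw [ind_apply]
  split_ifs <;> simp

theorem measurable_ind [MeasurableSpace α] {s : Set α} (hs : MeasurableSet s) :
    Measurable (ind s) :=
  measurable_const.indicator hs

theorem integral_ind [MeasurableSpace α] {μ : Measure α} {s : Set α} (hs : MeasurableSet s) :
    ∫ x, ind s x ∂μ = μ.real s :=
  integral_indicator_one hs

end Indicators

theorem measurableSet_condEvent {A : Set (Fin q → ℝ)} (hA : MeasurableSet A) :
    MeasurableSet (condEvent p A) :=
  measurable_snd hA

theorem measurableSet_pairEvent (a b : Fin p) {A : Set (Fin q → ℝ)} (hA : MeasurableSet A) :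
    MeasurableSet (pairEvent a b A) := by
  have h1 : ∀ c : Fin p, MeasurableSet {z : Obs p q × Obs p q | z.1.1 c < z.2.1 c} := fun c =>
    measurableSet_lt (by fun_prop) (by fun_prop)
  exact (h1 a).inter ((h1 b).inter ((measurable_snd.comp measurable_fst hA).inter
    (measurable_snd.comp measurable_snd hA)))

theorem ind_condEvent_inter (A B : Set (Fin q → ℝ)) (x : Obs p q) :
    ind (condEvent p (A ∩ B)) x = ind (condEvent p A) x * ind (condEvent p B) x := by
  classical
  simp only [ind_apply, condEvent, Set.mem_ofPred_eq, Set.mem_inter_iff]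
  split_ifs <;> simp_all

/-- The factor 2 undoes the average in `conc`. The fixed point `x` is put second, as `x₃` is in `I`
and `x₂` in `J`. -/
theorem ind_pairEvent_add_swap (a b : Fin p) (A : Set (Fin q → ℝ)) (x y : Obs p q) :
    ind (pairEvent a b A) (x, y) + ind (pairEvent a b A) (y, x)
      = 2 * (ind (condEvent p A) x * (ind (condEvent p A) y * conc a b y x)) := by
  classical
  simp only [ind_apply, condEvent, pairEvent, conc, ltEvent, Set.mem_ofPred_eq]
  by_cases hx : x.2 ∈ A <;> by_cases hy : y.2 ∈ A <;> simp [hx, hy]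
  ring

variable {μ : Measure (Obs p q)} [IsProbabilityMeasure μ] {A : Fin m → Set (Fin q → ℝ)}

omit [IsProbabilityMeasure μ] in
-- Multiplying by `p_k` cancels the normalization of the conditional law; this accounts for the
-- factors `p_k` in `sigmaE`.
theorem prob_mul_integral_condLaw (hA : ∀ k, MeasurableSet (A k)) (hpos : ∀ k, 0 < prob μ A k)
    (k : Fin m) (F : Obs p q → ℝ) :
    prob μ A k * ∫ x, F x ∂(condLaw μ A k) = ∫ x, ind (condEvent p (A k)) x * F x ∂μ := by
  have hs := measurableSet_condEvent (p := p) (hA k)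
  have hi : (fun x => ind (condEvent p (A k)) x * F x) = (condEvent p (A k)).indicator F := by
    ext x
    by_cases hx : x ∈ condEvent p (A k) <;> simp [ind, hx]
  rw [hi, integral_indicator hs, condLaw, ProbabilityTheory.cond, integral_smul_measure,
    ENNReal.toReal_inv, smul_eq_mul, ← mul_assoc]
  change prob μ A k * (prob μ A k)⁻¹ * _ = _
  rw [mul_inv_cancel₀ (hpos k).ne', one_mul]

/-- The centring and scaling apart, the i.i.d. summands in the linearization of the stacked
vector. -/
noncomputable def influence (μ : Measure (Obs p q)) (A : Fin m → Set (Fin q → ℝ)) : Idx p m → Obs p q → ℝ :=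
  Sum.elim (fun r => hoeffdingProj μ (ind (pairEvent r.1.1.1 r.1.1.2 (A r.2))))
    (fun k => ind (condEvent p (A k)))

theorem measurable_influence (hA : ∀ k, MeasurableSet (A k)) (i : Idx p m) :
    Measurable (influence μ A i) := by
  rcases i with r | k
  · exact measurable_hoeffdingProj (measurable_ind (measurableSet_pairEvent _ _ (hA _)))
  · exact measurable_ind (measurableSet_condEvent (hA k))

theorem memLp_influence (hA : ∀ k, MeasurableSet (A k)) (i : Idx p m) :
    MemLp (influence μ A i) 2 μ := by
  refine MemLp.of_bound (measurable_influence hA i).aestronglyMeasurable 2 (ae_of_all _ fun x => ?_)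
  rcases i with r | k
  · exact (abs_hoeffdingProj_le (abs_ind_le _) x).trans (by norm_num)
  · exact (abs_ind_le _ x).trans (by norm_num)

theorem integral_influence_inl (hA : ∀ k, MeasurableSet (A k)) (r : Pairs p × Fin m) :
    ∫ x, influence μ A (.inl r) x ∂μ = 2 * D μ A r.1.1.1 r.1.1.2 r.2 := by
  have hs := measurableSet_pairEvent r.1.1.1 r.1.1.2 (hA r.2)
  simp only [influence, Sum.elim_inl]
  rw [integral_hoeffdingProj (measurable_ind hs) (abs_ind_le _), integral_ind hs]
  rfl

omit [IsProbabilityMeasure μ] in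
theorem integral_influence_inr (hA : ∀ k, MeasurableSet (A k)) (k : Fin m) :
    ∫ x, influence μ A (.inr k) x ∂μ = prob μ A k :=
  integral_ind (measurableSet_condEvent (hA k))

theorem influence_inl_apply (hA : ∀ k, MeasurableSet (A k)) (hpos : ∀ k, 0 < prob μ A k)
    (r : Pairs p × Fin m) (x : Obs p q) :
    influence μ A (.inl r) x = 2 * prob μ A r.2 *
      (ind (condEvent p (A r.2)) x * ∫ y, conc r.1.1.1 r.1.1.2 y x ∂(condLaw μ A r.2)) := by
  have hm := measurable_ind (measurableSet_pairEvent r.1.1.1 r.1.1.2 (hA r.2))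
  simp only [influence, Sum.elim_inl, hoeffdingProj]
  have h1 : Integrable (fun y => ind (pairEvent r.1.1.1 r.1.1.2 (A r.2)) (x, y)) μ :=
    integrable_of_abs_le (hm.comp (by fun_prop)).aemeasurable fun y => abs_ind_le _ (x, y)
  have h2 : Integrable (fun y => ind (pairEvent r.1.1.1 r.1.1.2 (A r.2)) (y, x)) μ :=
    integrable_of_abs_le (hm.comp (by fun_prop)).aemeasurable fun y => abs_ind_le _ (y, x)
  rw [← integral_add h1 h2]
  simp_rw [ind_pairEvent_add_swap]
  rw [integral_const_mul, integral_const_mul, ← prob_mul_integral_condLaw hA hpos]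
  ring

/-- Each `D` coordinate carries a factor `2 * p_k` and has mean `2 * D`, which gives the constants 4
and 2 in the blocks. Products of indicators become indicators of `A k ∩ A l`, so overlapping sets
need no separate treatment. -/
theorem sigmaE_eq_covMatrix (hA : ∀ k, MeasurableSet (A k)) (hpos : ∀ k, 0 < prob μ A k) :
    sigmaE μ A = covMatrix μ (influence μ A) := by
  have hDp : ∀ r l, sigmaDp μ A r l = cov[influence μ A (.inl r), influence μ A (.inr l); μ] := by
    intro r l
    rw [covariance_eq_sub (memLp_influence hA _) (memLp_influence hA _),
      integral_influence_inl hA, integral_influence_inr hA]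
    simp only [sigmaDp, Matrix.of_apply, J, ind_condEvent_inter, Pi.mul_apply, integral_const_mul,
      influence_inl_apply hA hpos]
    rw [← integral_const_mul]
    congr 1
    refine integral_congr_ae (ae_of_all _ fun x => ?_)
    simp only [influence, Sum.elim_inr]
    ring
  ext i j
  rw [covMatrix, Matrix.of_apply]
  rcases i with r | k <;> rcases j with s | l
  · rw [covariance_eq_sub (memLp_influence hA _) (memLp_influence hA _),
      integral_influence_inl hA, integral_influence_inl hA]
    simp only [sigmaE, Matrix.fromBlocks_apply₁₁, sigmaDD, Matrix.of_apply, I,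
      ind_condEvent_inter, Pi.mul_apply, integral_const_mul, integral_mul_const,
      influence_inl_apply hA hpos]
    rw [← integral_const_mul]
    congr 1
    · refine integral_congr_ae (ae_of_all _ fun x => ?_)
      ring
    · ring
  · exact hDp r l
  · rw [covariance_comm]
    exact hDp s k
  · rw [covariance_eq_sub (memLp_influence hA _) (memLp_influence hA _),
      integral_influence_inr hA, integral_influence_inr hA]
    simp only [sigmaE, Matrix.fromBlocks_apply₂₂, sigmapp, Matrix.of_apply, prob₂]
    rw [← integral_ind (measurableSet_condEvent ((hA k).inter (hA l)))]
    simp only [ind_condEvent_inter, influence, Sum.elim_inr, Pi.mul_apply]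

omit [IsProbabilityMeasure μ] in
theorem measurable_VHat (hA : ∀ k, MeasurableSet (A k)) (n : ℕ) :
    Measurable fun x : ℕ → Obs p q => VHat μ A n x := by
  refine (WithLp.measurable_toLp 2 (Idx p m → ℝ)).comp (measurable_pi_lambda _ fun i => ?_)
  rcases i with r | k
  · have hm := measurable_ind (measurableSet_pairEvent r.1.1.1 r.1.1.2 (hA r.2))
    exact ((Finset.measurable_fun_sum _ fun i _ => Finset.measurable_fun_sum _ fun j _ =>
      hm.comp (by fun_prop)).const_mul _).sub_const _
  · have hm := measurable_ind (measurableSet_condEvent (p := p) (hA k))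
    exact ((Finset.measurable_fun_sum _ fun i _ => hm.comp (by fun_prop)).const_mul _).sub_const _

/-- The error in the linearization of the stacked vector. -/
noncomputable def linearizationError (μ : Measure (Obs p q)) (A : Fin m → Set (Fin q → ℝ)) (n : ℕ)
    (x : ℕ → Obs p q) : EuclideanSpace ℝ (Idx p m) :=
  Real.sqrt n • VHat μ A n x - WithLp.toLp 2 fun i => (Real.sqrt n)⁻¹ *
    (∑ k ∈ Finset.range n, influence μ A i (x k) - n * ∫ y, influence μ A i y ∂μ)

omit [IsProbabilityMeasure μ] in
theorem linearizationError_inl (hA : ∀ k, MeasurableSet (A k)) (n : ℕ) (x : ℕ → Obs p q)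
    (r : Pairs p × Fin m) :
    linearizationError μ A n x (.inl r)
      = remainder μ (ind (pairEvent r.1.1.1 r.1.1.2 (A r.2))) n x := by
  rw [remainder, integral_ind (measurableSet_pairEvent _ _ (hA _))]
  rfl

-- An empirical mean is already linear in the observations, so nothing is left over.
omit [IsProbabilityMeasure μ] in
theorem linearizationError_inr (hA : ∀ k, MeasurableSet (A k)) (n : ℕ) (x : ℕ → Obs p q)
    (k : Fin m) : linearizationError μ A n x (.inr k) = 0 := by
  have e : linearizationError μ A n x (.inr k)
      = Real.sqrt n * (1 / (n : ℝ) * ∑ i ∈ Finset.range n, ind (condEvent p (A k)) (x i)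
          - prob μ A k) - (Real.sqrt n)⁻¹ * (∑ i ∈ Finset.range n, ind (condEvent p (A k)) (x i)
          - n * prob μ A k) := by
    change Real.sqrt n * (_ - prob μ A k) - _ = _
    rw [prob, ← integral_ind (measurableSet_condEvent (hA k))]
    rfl
  rw [e]
  -- At `n = 0` both terms vanish, since `√0` and its inverse are 0.
  rcases Nat.eq_zero_or_pos n with rfl | hn
  · simp
  · have hs : Real.sqrt n ≠ 0 := by positivity
    have hs2 : Real.sqrt n ^ 2 = n := Real.sq_sqrt (by positivity)
    field_simp
    rw [hs2]
    ring

end CondKendall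

theorem mainTheorem4 (p q m : ℕ) (hp : 2 < p)
    (A : Fin m → Set (Fin q → ℝ)) (hA : ∀ k, MeasurableSet (A k))
    (μ : Measure (CondKendall.Obs p q)) [IsProbabilityMeasure μ]
    (hpos : ∀ k, 0 < CondKendall.prob μ A k)
    {Ω : Type*} [MeasurableSpace Ω] (P : Measure Ω) [IsProbabilityMeasure P]
    (X : ℕ → Ω → CondKendall.Obs p q)
    (hindep : iIndepFun X P) (hlaw : ∀ i, HasLaw (X i) μ P) :
    Fintype.card (CondKendall.Idx p m) = m * (p * (p - 1) / 2) + m ∧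
    (CondKendall.sigmaE μ A).PosSemidef ∧
    TendstoInDistribution
      (fun (n : ℕ) (ω : Ω) => Real.sqrt n • CondKendall.VHat μ A n (fun i => X i ω))
      atTop
      (fun v : EuclideanSpace ℝ (CondKendall.Idx p m) => v)
      (fun _ => P)
      (multivariateGaussian 0 (CondKendall.sigmaE μ A)) := by
  have hX : ∀ i, AEMeasurable (X i) P := fun i => (hlaw i).aemeasurable
  have hf := CondKendall.memLp_influence (μ := μ) hA
  rw [CondKendall.sigmaE_eq_covMatrix hA hpos]
  refine ⟨CondKendall.card_idx p m, MultivariateCLT.posSemidef_covMatrix hf, ?_⟩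
  -- Slutsky's lemma: the linearized vector has the Gaussian limit, and the linearization error
  -- tends to 0 in probability because its coordinates do so in mean square.
  refine tendstoInDistribution_of_tendstoInMeasure_sub _ _
    (MultivariateCLT.tendstoInDistribution_inv_sqrt_smul_sum_sub hindep hlaw
      (CondKendall.measurable_influence hA) hf) ?_ fun n =>
    ((CondKendall.measurable_VHat hA n).const_smul (Real.sqrt n)).comp_aemeasurable
      (aemeasurable_pi_lambda (fun ω i => X i ω) hX)
  change TendstoInMeasure P
    (fun n ω => CondKendall.linearizationError μ A n fun i => X i ω) atTop 0
  refine UStatistic.tendstoInMeasure_of_tendsto_integral_sq (fun n i => ?_) fun i => ?_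
  · rcases i with r | k
    · simp only [CondKendall.linearizationError_inl hA]
      exact UStatistic.memLp_remainder hX
        (CondKendall.measurable_ind (CondKendall.measurableSet_pairEvent _ _ (hA _)))
        (CondKendall.abs_ind_le _) n
    · simp [CondKendall.linearizationError_inr hA]
  · rcases i with r | k
    · simp only [CondKendall.linearizationError_inl hA]
      exact UStatistic.tendsto_integral_sq_remainder hindep hlaw
        (CondKendall.measurable_ind (CondKendall.measurableSet_pairEvent _ _ (hA _)))
        (CondKendall.abs_ind_le _)
    · simp [CondKendall.linearizationError_inr hA]
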